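/- Let $(X,d_X)$ be a nonempty compact metric space and let $\mathfrak A$ be a unital C*-algebra. Let $C(X,\mathfrak A)$ be the unital C*-algebra of continuous $\mathfrak A$-valued functions on $X$ (pointwise operations, supremum norm), and let $C(X,\mathbb C1_{\mathfrak A})$ be its C*-subalgebra of functions with values in $\mathbb C1_{\mathfrak A}$. Let $E:C(X,\mathfrak A)\to C(X,\mathbb C1_{\mathfrak A})$ be a conditional expectation onto $C(X,\mathbb C1_{\mathfrak A})$, that is, a contractive linear map with $E(g)=g$ for all $g\in C(X,\mathbb C1_{\mathfrak A})$. Let $r>0$ be real and, for every self-adjoint $f\in C(X,\mathfrak A)$, put $$\mathsf L(f)=\sup_{x,y\in X}\frac{\|f(x)-f(y)\|_{\mathfrak A}}{d_X(x,y)}+\frac{\|f-E(f)\|_{C(X,\mathfrak A)}}{r}\in[0,\infty],$$ where $0/0=0$. Then the following are equivalent: 1. $(C(X,\mathfrak A),\mathsf L)$ is a $2$-quasi-Leibniz compact quantum metric space; 2. $\mathfrak A$ is finite-dimensional. Here, for a unital C*-algebra $\mathfrak B$ with self-adjoint part $\mathfrak{sa}(\mathfrak B)$ and state space $\mathscr S(\mathfrak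 B)$, a pair $(\mathfrak B,\mathsf L)$ is a compact quantum metric space if $\mathsf L$ is a seminorm on a dense real subspace $\operatorname{dom}(\mathsf L)$ of $\mathfrak{sa}(\mathfrak B)$ containing $1_{\mathfrak B}$ (extended by $\infty$ to $\mathfrak{sa}(\mathfrak B)$, so that $\operatorname{dom}(\mathsf L)=\{a:\mathsf L(a)<\infty\}$) such that: (i) $\{a\in\mathfrak{sa}(\mathfrak B):\mathsf L(a)=0\}=\mathbb R1_{\mathfrak B}$; (ii) the formula $\mathsf{mk}_{\mathsf L}(\varphi,\psi)=\sup\{|\varphi(a)-\psi(a)|:a\in\operatorname{dom}(\mathsf L),\ \mathsf L(a)\le1\}$ defines a metric on $\mathscr S(\mathfrak B)$ that induces the weak* topology; (iii) $\mathsf L$ is lower semicontinuous on $\mathfrak{sa}(\mathfrak B)$ for the norm. For $C\ge1$ it is $C$-quasi-Leibniz if, for all $a,b\in\mathfrak{sa}(\mathfrak B)$ (with the convention $0\cdot\infty=0$), $$\max\left\{\mathsf L\left(\tfrac{ab+ba}{2}\right),\ \mathsf L\left(\tfrac{ab-ba}{2i}\right)\right\}\le C\left(\mathsf L(a)\|b\|_{\mathfrak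 B}+\mathsf L(b)\|a\|_{\mathfrak B}\right).$$ -/

import Mathlib

open scoped ENNReal NNReal

noncomputable section

namespace QuantumMetric

section General

variable {A : Type*} [CStarAlgebra A]

/-- The state space of a unital C*-algebra `A`: the positive linear functionals `φ` with
`φ 1 = 1`, with the weak* topology (as a subset of `WeakDual ℂ A`). -/
def stateSpace (A : Type*) [CStarAlgebra A] : Set (WeakDual ℂ A) :=
  {φ | (∀ a : A, ∃ t : ℝ, 0 ≤ t ∧ φ (star a * a) = (t : ℂ)) ∧ φ 1 = 1}

/-- The weak* topology on the state space, induced by the one of `WeakDual ℂ A`. -/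
abbrev weakStarTopology (A : Type*) [CStarAlgebra A] : TopologicalSpace (stateSpace A) :=
  TopologicalSpace.induced Subtype.val (inferInstance : TopologicalSpace (WeakDual ℂ A))

/-- The Jordan product `(ab + ba) / 2` of two self-adjoint elements. -/
def jordanProd (a b : selfAdjoint A) : selfAdjoint A :=
  ⟨(2 : ℂ)⁻¹ • ((a : A) * b + b * a), by
    have ha : star (a : A) = a := a.2
    have hb : star (b : A) = b := b.2
    rw [selfAdjoint.mem_iff]
    simp [star_smul, ha, hb, add_comm]⟩

/-- The Lie product `(ab - ba) / (2i)` of two self-adjoint elements. -/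
def lieProd (a b : selfAdjoint A) : selfAdjoint A :=
  ⟨(2 * Complex.I)⁻¹ • ((a : A) * b - b * a), by
    have ha : star (a : A) = a := a.2
    have hb : star (b : A) = b := b.2
    rw [selfAdjoint.mem_iff, star_smul, star_sub, star_mul, star_mul, ha, hb,
      ← neg_sub ((a : A) * b) (b * a), smul_neg, ← neg_smul]
    congr 1
    simp⟩

/-- The Monge-Kantorovich distance between two states. The function `L` takes the value `∞`
off its domain, so the supremum runs over elements of the domain. -/
def mongeKantorovich (L : selfAdjoint A → ℝ≥0∞) (φ ψ : stateSpace A) : ℝ≥0∞ :=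
  ⨆ (a : selfAdjoint A) (_ : L a ≤ 1), ‖φ.1 (a : A) - ψ.1 (a : A)‖ₑ

/-- `(A, L)` is a compact quantum metric space. A seminorm defined on a subspace of the
self-adjoint part of `A` is encoded by its extension by `∞` to all self-adjoint elements;
its domain is `{a | L a < ∞}`. -/
structure IsCompactQuantumMetricSpace (L : selfAdjoint A → ℝ≥0∞) : Prop where
  /-- subadditivity; in particular the domain is closed under addition -/
  add_le : ∀ a b, L (a + b) ≤ L a + L b
  /-- homogeneity (with `0 * ∞ = 0`); in particular the domain is closed under real scalars -/
  smul_eq : ∀ (t : ℝ) (a : selfAdjoint A), L (t • a) = ‖t‖ₑ * L a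
  /-- the domain contains the unit -/
  one_mem : L 1 < ∞
  /-- the domain is dense in the self-adjoint part -/
  dense_dom : Dense {a : selfAdjoint A | L a < ∞}
  /-- `L` vanishes exactly on the real multiples of the unit -/
  ker_eq : {a : selfAdjoint A | L a = 0} = {a | ∃ t : ℝ, a = t • (1 : selfAdjoint A)}
  /-- the Monge-Kantorovich distance is a (finite) metric inducing the weak* topology -/
  metrizes : ∃ m : MetricSpace (stateSpace A),
    (∀ φ ψ : stateSpace A, mongeKantorovich L φ ψ = ENNReal.ofReal (m.dist φ ψ)) ∧
    m.toUniformSpace.toTopologicalSpace = weakStarTopology A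
  /-- lower semicontinuity for the C*-norm -/
  lsc : LowerSemicontinuous L

/-- `L` is `C`-quasi-Leibniz. -/
def IsQuasiLeibniz (C : ℝ≥0) (L : selfAdjoint A → ℝ≥0∞) : Prop :=
  1 ≤ C ∧ ∀ a b : selfAdjoint A,
    L (jordanProd a b) ≤ C * (L a * ‖(b : A)‖ₑ + L b * ‖(a : A)‖ₑ) ∧
    L (lieProd a b) ≤ C * (L a * ‖(b : A)‖ₑ + L b * ‖(a : A)‖ₑ)

/-- `(A, L)` is a `C`-quasi-Leibniz compact quantum metric space. -/
def IsQuasiLeibnizCQMS (C : ℝ≥0) (L : selfAdjoint A → ℝ≥0∞) : Prop :=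
  IsCompactQuantumMetricSpace L ∧ IsQuasiLeibniz C L

/-- A conditional expectation of `A` onto a C*-subalgebra `B`: a contractive linear map
`A → B` restricting to the identity on `B`. (Such a `B` is automatically norm closed.) -/
structure IsConditionalExpectation {B : StarSubalgebra ℂ A} (E : A →ₗ[ℂ] B) : Prop where
  apply_coe : ∀ b : B, E (b : A) = b
  contractive : ∀ a : A, ‖E a‖ ≤ ‖a‖

end General

section Functions

variable (X : Type*) [MetricSpace X] [CompactSpace X] (A : Type*) [CStarAlgebra A]

/-- `C(X, ℂ1)`: the continuous functions `X → A` with values in the scalar multiples of the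
unit, as a star subalgebra of `C(X, A)`. -/
def scalarFunctions : StarSubalgebra ℂ C(X, A) where
  carrier := {f | ∀ x, ∃ c : ℂ, f x = c • (1 : A)}
  mul_mem' := by
    intro f g hf hg x
    obtain ⟨c, hc⟩ := hf x
    obtain ⟨d, hd⟩ := hg x
    exact ⟨c * d, by simp [hc, hd, smul_smul, mul_comm]⟩
  add_mem' := by
    intro f g hf hg x
    obtain ⟨c, hc⟩ := hf x
    obtain ⟨d, hd⟩ := hg x
    exact ⟨c + d, by simp [hc, hd, add_smul]⟩
  algebraMap_mem' := fun c _ => ⟨c, by simp [Algebra.algebraMap_eq_smul_one]⟩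
  star_mem' := by
    intro f hf x
    obtain ⟨c, hc⟩ := hf x
    exact ⟨star c, by simp [hc, star_smul]⟩

variable {X A}

/-- The Lipschitz constant of `f : X → A` with values in `[0, ∞]`
(in `ℝ≥0∞`, `0 / 0 = 0`, so pairs `x = y` contribute `0`). -/
def lipConst (f : C(X, A)) : ℝ≥0∞ :=
  ⨆ (x : X) (y : X), ‖f x - f y‖ₑ / edist x y

/-- `L(f) = Lip(f) + ‖f - E(f)‖ / r` on the self-adjoint part of `C(X, A)`. -/
def lipNorm (E : C(X, A) →ₗ[ℂ] scalarFunctions X A) (r : ℝ) (f : selfAdjoint C(X, A)) :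
    ℝ≥0∞ :=
  lipConst (f : C(X, A)) +
    ‖(f : C(X, A)) - (E (f : C(X, A)) : C(X, A))‖ₑ / ENNReal.ofReal r

end Functions

end QuantumMetric

end

/-! Finite dimension is exactly what makes the unit ball of `L` totally bounded modulo scalars. If
`A` is finite-dimensional, an `f` with `L f ≤ 1` is 1-Lipschitz and lies within `r` of the
scalar-valued function `E f`. Subtracting a real scalar therefore bounds it by `r` at a base point,
and Arzelà–Ascoli applies because `A` is proper (`totallyBounded_setOf_lipConst_le_one`). Total
boundedness modulo scalars lets finitely many evaluations control the Monge-Kantorovich distance, so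
it metrizes the weak* topology (`metrizes_of_totallyBounded`). The quasi-Leibniz constant 2 arises
because `‖f - E f‖` is at most twice the distance from `f` to the scalar functions. Conversely, on
constant functions the Lipschitz term vanishes and `L` is at most `2 / r` times the norm.
Norm-bounded self-adjoint elements of `A` thus become equi-Lipschitz functions on the compact state
space. Arzelà–Ascoli makes them precompact in the sup norm, which is the norm of `A` because states
attain it; Riesz's lemma then forces finite dimension (`finiteDimensional_of_metrizes`). -/

open scoped ENNReal NNReal
open Filter Topology

noncomputable section

namespace QuantumMetric

set_option linter.unusedSectionVars false

/-! ### States: bounds, weak* compactness, norm attainment -/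

section States

variable {B : Type*} [CStarAlgebra B]

variable (B) in
theorem norm_one_le_one : ‖(1 : B)‖ ≤ 1 := by
  rcases subsingleton_or_nontrivial B with h | h
  · simp [Subsingleton.elim (1 : B) 0]
  · exact CStarRing.norm_one.le

theorem stateSpace.nonneg_real (φ : stateSpace B) {b : B} (hb : ∃ c : B, b = star c * c) :
    ∃ t : ℝ, 0 ≤ t ∧ φ.1 b = (t : ℂ) := by
  obtain ⟨c, rfl⟩ := hb
  exact φ.2.1 c

/-- `‖a‖ - a` and `‖a‖ + a` are of the form `star c * c` for self-adjoint `a`. -/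
theorem exists_norm_sub_eq_star_mul {a : B} (ha : IsSelfAdjoint a) :
    ∃ c : B, (‖a‖ : ℂ) • (1 : B) - a = star c * c := by
  let _ := CStarAlgebra.spectralOrder B
  have _ := CStarAlgebra.spectralOrderedRing B
  have h := sub_nonneg.2 ha.le_algebraMap_norm_self
  obtain ⟨c, hc⟩ := CStarAlgebra.nonneg_iff_eq_star_mul_self.1 h
  refine ⟨c, ?_⟩
  rw [← hc, Algebra.algebraMap_eq_smul_one]
  norm_cast

/-- Positivity of `φ` at both `‖a‖ - a` and `‖a‖ + a` gives reality and the bound at once. -/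
theorem stateSpace.apply_sa (φ : stateSpace B) {a : B} (ha : IsSelfAdjoint a) :
    ∃ t : ℝ, |t| ≤ ‖a‖ ∧ φ.1 a = (t : ℂ) := by
  obtain ⟨s, hs, h⟩ := stateSpace.nonneg_real φ (exists_norm_sub_eq_star_mul ha)
  obtain ⟨u, hu, h'⟩ := stateSpace.nonneg_real φ (exists_norm_sub_eq_star_mul ha.neg)
  rw [map_sub, map_smul, φ.2.2] at h h'
  rw [map_neg, norm_neg] at h'
  refine ⟨‖a‖ - s, ?_, ?_⟩
  · have h1 : (‖a‖ : ℂ) - s = u - ‖a‖ := by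
      rw [← h, ← h']; simp
    have h2 : ‖a‖ - s = u - ‖a‖ := by exact_mod_cast h1
    rw [abs_le]; constructor <;> linarith
  · push_cast
    rw [← h]; simp

theorem stateSpace.norm_apply_sa_le (φ : stateSpace B) {a : B} (ha : IsSelfAdjoint a) :
    ‖φ.1 a‖ ≤ ‖a‖ := by
  obtain ⟨t, ht, h⟩ := stateSpace.apply_sa φ ha
  rw [h, Complex.norm_real]
  exact ht

/-- Splitting into real and imaginary parts costs a factor 2, harmless for the compactness arguments
below. -/
theorem stateSpace.norm_apply_le (φ : stateSpace B) (a : B) : ‖φ.1 a‖ ≤ 2 * ‖a‖ := by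
  conv_lhs => rw [← realPart_add_I_smul_imaginaryPart a, map_add, map_smul]
  have h1 := stateSpace.norm_apply_sa_le φ (realPart a).2
  have h2 := stateSpace.norm_apply_sa_le φ (imaginaryPart a).2
  have h3 := realPart.norm_le a
  have h4 := imaginaryPart.norm_le a
  refine (norm_add_le _ _).trans ?_
  rw [norm_smul, Complex.norm_I, one_mul]
  simp only [AddSubgroup.norm_coe] at *
  linarith

theorem isClosed_stateSpace : IsClosed (stateSpace B) := by
  have h1 : IsClosed {z : ℂ | ∃ t : ℝ, 0 ≤ t ∧ z = (t : ℂ)} := by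
    have : {z : ℂ | ∃ t : ℝ, 0 ≤ t ∧ z = (t : ℂ)} = {z | 0 ≤ z.re} ∩ {z | z.im = 0} := by
      ext z
      constructor
      · rintro ⟨t, ht, rfl⟩
        exact ⟨by simpa using ht, by simp⟩
      · rintro ⟨h, h'⟩
        exact ⟨z.re, h, Complex.ext (by simp) (by simpa using h')⟩
    rw [this]
    exact (isClosed_le continuous_const Complex.continuous_re).inter
      (isClosed_eq Complex.continuous_im continuous_const)
  have : stateSpace B = (⋂ a : B, {φ : WeakDual ℂ B | φ (star a * a) ∈
      {z : ℂ | ∃ t : ℝ, 0 ≤ t ∧ z = (t : ℂ)}}) ∩ {φ | φ 1 = 1} := by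
    ext φ
    simp [stateSpace]
  rw [this]
  exact (isClosed_iInter fun a => h1.preimage (WeakDual.eval_continuous _)).inter
    (isClosed_eq (WeakDual.eval_continuous _) continuous_const)

theorem isCompact_stateSpace : IsCompact (stateSpace B) := by
  refine (WeakDual.isCompact_closedBall (0 : StrongDual ℂ B) 2).of_isClosed_subset
    isClosed_stateSpace fun φ hφ => ?_
  simp only [Set.mem_preimage, mem_closedBall_zero_iff]
  exact ContinuousLinearMap.opNorm_le_bound _ (by norm_num)
    fun a => stateSpace.norm_apply_le ⟨φ, hφ⟩ a

/-- Shift `a` by `t * I`: the squared norm grows by at most `t ^ 2`, while the squared value of `φ`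
is at least `((φ a).im - t) ^ 2`. The `t ^ 2` cancels, and a linear function of `t` bounded above
must be constant. -/
theorem im_apply_eq_zero {φ : StrongDual ℂ B} (h : ∀ b, ‖φ b‖ ≤ ‖b‖) (h1 : φ 1 = 1) {a : B}
    (ha : IsSelfAdjoint a) : (φ a).im = 0 := by
  have key : ∀ t : ℝ, (φ a).im ^ 2 - 2 * t * (φ a).im ≤ ‖a‖ ^ 2 * ‖(1 : B)‖ ^ 2 + ‖a‖ ^ 2 := by
    intro t
    have e : ‖a - (t * Complex.I) • (1 : B)‖ ^ 2 ≤ ‖a‖ ^ 2 + t ^ 2 := by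
      rw [sq, ← CStarRing.norm_star_mul_self]
      have : star (a - (t * Complex.I) • (1 : B)) * (a - (t * Complex.I) • (1 : B))
          = a * a + ((t ^ 2 : ℝ) : ℂ) • (1 : B) := by
        have : star ((t : ℂ) * Complex.I) = - (t * Complex.I) := by simp
        have h2 : ((t : ℂ) * Complex.I) * (t * Complex.I) = -((t ^ 2 : ℝ) : ℂ) := by
          push_cast; ring_nf; simp
        rw [star_sub, ha.star_eq, star_smul, star_one, this, neg_smul, sub_neg_eq_add, add_mul,
          mul_sub, mul_sub]
        simp only [mul_smul_comm, smul_mul_assoc, mul_one, one_mul, smul_smul, h2, neg_smul]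
        abel
      rw [this]
      refine (norm_add_le _ _).trans (add_le_add ((norm_mul_le _ _).trans_eq (sq _).symm) ?_)
      rw [norm_smul, Complex.norm_real, Real.norm_of_nonneg (sq_nonneg t)]
      exact mul_le_of_le_one_right (sq_nonneg t) (norm_one_le_one B)
    have f := h (a - (t * Complex.I) • (1 : B))
    rw [map_sub, map_smul, h1, smul_eq_mul, mul_one] at f
    have g : ((φ a).im - t) ^ 2 ≤ ‖φ a - t * Complex.I‖ ^ 2 := by
      rw [← Complex.normSq_eq_norm_sq, Complex.normSq_apply]
      simp only [Complex.sub_im, Complex.mul_im, Complex.ofReal_re, Complex.I_im, mul_one,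
        Complex.ofReal_im, Complex.I_re, mul_zero, add_zero]
      nlinarith [mul_self_nonneg (φ a - t * Complex.I).re]
    have k := pow_le_pow_left₀ (norm_nonneg _) f 2
    nlinarith [sq_nonneg (‖a‖ * ‖(1 : B)‖)]
  by_contra hne
  -- This `t` makes the linear term equal to the upper bound, leaving `(φ a).im ^ 2 ≤ 0`.
  have := key (-((‖a‖ ^ 2 * ‖(1 : B)‖ ^ 2 + ‖a‖ ^ 2) / (2 * (φ a).im)))
  have hp : 0 < (φ a).im ^ 2 := by positivity
  have e : 2 * (-((‖a‖ ^ 2 * ‖(1 : B)‖ ^ 2 + ‖a‖ ^ 2) / (2 * (φ a).im))) * (φ a).im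
    = -(‖a‖ ^ 2 * ‖(1 : B)‖ ^ 2 + ‖a‖ ^ 2) := by field_simp
  rw [e] at this
  linarith

/-- A norm-decreasing functional `φ` with `φ 1 = 1` is a state. -/
theorem mem_stateSpace_of_norm_le {φ : StrongDual ℂ B} (h : ∀ b, ‖φ b‖ ≤ ‖b‖) (h1 : φ 1 = 1) :
    StrongDual.toWeakDual φ ∈ stateSpace B := by
  refine ⟨fun a => ?_, h1⟩
  let _ := CStarAlgebra.spectralOrder B
  have _ := CStarAlgebra.spectralOrderedRing B
  have hsa : IsSelfAdjoint (star a * a) := IsSelfAdjoint.star_mul_self a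
  have him := im_apply_eq_zero h h1 hsa
  refine ⟨(φ (star a * a)).re, ?_, Complex.ext (by simp) (by simpa using him)⟩
  set p := star a * a with hp
  have hp0 : 0 ≤ p := star_mul_self_nonneg a
  -- Since `φ` is contractive, this puts `φ p` within `‖p‖` of `‖p‖`, so its real part is
  -- nonnegative.
  have hle : ‖algebraMap ℝ B ‖p‖ - p‖ ≤ ‖p‖ := by
    have h2 : algebraMap ℝ B ‖p‖ - p ≤ algebraMap ℝ B ‖p‖ := sub_le_self _ hp0
    have h3 : 0 ≤ algebraMap ℝ B ‖p‖ - p := sub_nonneg.2 hsa.le_algebraMap_norm_self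
    refine (CStarAlgebra.norm_le_norm_of_nonneg_of_le h3 h2).trans ?_
    rw [Algebra.algebraMap_eq_smul_one, norm_smul, norm_norm]
    exact mul_le_of_le_one_right (norm_nonneg _) (norm_one_le_one B)
  have e : algebraMap ℝ B ‖p‖ = (‖p‖ : ℂ) • (1 : B) := by
    rw [Algebra.algebraMap_eq_smul_one]; norm_cast
  have f := (h _).trans hle
  rw [e, map_sub, map_smul, h1, smul_eq_mul, mul_one] at f
  have g := (Complex.abs_re_le_norm _).trans f
  rw [Complex.sub_re, Complex.ofReal_re] at g
  linarith [(abs_le.1 g).2]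

/-- Every self-adjoint element attains its norm at some state. -/
theorem exists_state_norm_apply_eq [Nontrivial B] {a : B} (ha : IsSelfAdjoint a) :
    ∃ φ : stateSpace B, ‖φ.1 a‖ = ‖a‖ := by
  have : IsStarNormal a := ha.isStarNormal
  -- Gelfand theory on the commutative algebra generated by `a` gives a character attaining the
  -- norm. Its Hahn–Banach extension is contractive and unital, hence a state.
  let S := StarAlgebra.elemental ℂ a
  let a' : S := ⟨a, StarAlgebra.elemental.self_mem ℂ a⟩
  obtain ⟨χ, -, hχ⟩ := (isCompact_univ (X := WeakDual.characterSpace ℂ S)).exists_isMaxOn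
    Set.univ_nonempty (f := fun χ => ‖χ a'‖)
    (WeakDual.gelfandTransform ℂ S a').continuous.norm.continuousOn
  have hn : ‖a‖ ≤ ‖χ a'‖ := by
    have h1 : ‖WeakDual.gelfandTransform ℂ S a'‖ = ‖a'‖ := by
      simpa using (gelfandTransform_isometry S).norm_map_of_map_zero (map_zero _) a'
    change ‖a'‖ ≤ _
    rw [← h1]
    exact (ContinuousMap.norm_le _ (norm_nonneg _)).2 fun ψ => hχ (Set.mem_univ ψ)
  let f : StrongDual ℂ S := WeakDual.toStrongDual χ.1
  have hf : ‖f‖ ≤ 1 := by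
    refine f.opNorm_le_bound zero_le_one fun b => ?_
    rw [one_mul]
    exact spectrum.norm_le_norm_of_mem (WeakDual.CharacterSpace.apply_mem_spectrum χ b)
  obtain ⟨g, hg, hgn⟩ := exists_extension_norm_eq (Subalgebra.toSubmodule S.toSubalgebra) f
  have hgb : ∀ b, ‖g b‖ ≤ ‖b‖ := fun b => by
    refine (g.le_opNorm b).trans ?_
    rw [hgn]
    exact mul_le_of_le_one_left (norm_nonneg _) hf
  have hg1 : g 1 = 1 := (hg (1 : S)).trans (map_one χ)
  refine ⟨⟨_, mem_stateSpace_of_norm_le hgb hg1⟩, le_antisymm (hgb a) ?_⟩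
  refine hn.trans_eq ?_
  congr 1
  exact (hg a').symm

end States

/-! ### Total boundedness and the Monge-Kantorovich metric -/

section Metrization

variable {B : Type*} [CStarAlgebra B]

theorem topologicalSpace_le_of_eventually_dist_lt {S : Type*} (t : TopologicalSpace S)
    (m : MetricSpace S) (h : ∀ (φ : S), ∀ ε > 0, ∀ᶠ ψ in @nhds S t φ, m.dist ψ φ < ε) :
    t ≤ m.toUniformSpace.toTopologicalSpace := by
  rw [← continuous_id_iff_le]
  refine @continuous_iff_continuousAt S S t m.toUniformSpace.toTopologicalSpace _ |>.2 fun φ => ?_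
  exact (@Metric.tendsto_nhds S S m.toPseudoMetricSpace (@nhds S t φ) id φ).2 fun ε hε => h φ ε hε

theorem continuous_of_continuous_eval_selfAdjoint {S : Type*} [TopologicalSpace S]
    {g : S → WeakDual ℂ B} (h : ∀ a : selfAdjoint B, Continuous fun s => g s (a : B)) :
    Continuous g := by
  refine WeakDual.continuous_of_continuous_eval fun a => ?_
  have he : (fun s => g s a) = fun s =>
      g s (realPart a : B) + Complex.I • g s (imaginaryPart a : B) := by
    funext s
    conv_lhs => rw [← realPart_add_I_smul_imaginaryPart a, map_add, map_smul]
  rw [he]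
  exact (h _).add ((h _).const_smul Complex.I)

theorem mongeKantorovich_comm (L : selfAdjoint B → ℝ≥0∞) (φ ψ : stateSpace B) :
    mongeKantorovich L φ ψ = mongeKantorovich L ψ φ := by
  unfold mongeKantorovich
  simp_rw [enorm_sub_rev]

theorem mongeKantorovich_triangle (L : selfAdjoint B → ℝ≥0∞) (φ ψ χ : stateSpace B) :
    mongeKantorovich L φ χ ≤ mongeKantorovich L φ ψ + mongeKantorovich L ψ χ := by
  refine iSup₂_le fun a ha => ?_
  have h : φ.1 (a : B) - χ.1 (a : B) = (φ.1 (a : B) - ψ.1 (a : B)) + (ψ.1 (a : B) - χ.1 (a : B)) := by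
    abel
  rw [h]
  exact (enorm_add_le _ _).trans (add_le_add
    (le_iSup₂ (f := fun (a : selfAdjoint B) (_ : L a ≤ 1) => ‖φ.1 (a : B) - ψ.1 (a : B)‖ₑ) a ha)
    (le_iSup₂ (f := fun (a : selfAdjoint B) (_ : L a ≤ 1) => ‖ψ.1 (a : B) - χ.1 (a : B)‖ₑ) a ha))

variable {L : selfAdjoint B → ℝ≥0∞}

/-- All states agree on scalars, so test elements matter only modulo scalars. -/
theorem mongeKantorovich_le {K : Set B}
    (hK : ∀ a : selfAdjoint B, L a ≤ 1 → ∃ t : ℝ, (a : B) - (t : ℂ) • (1 : B) ∈ K)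
    {φ ψ : stateSpace B} {M : ℝ} (hM : ∀ k ∈ K, ‖φ.1 k - ψ.1 k‖ ≤ M) :
    mongeKantorovich L φ ψ ≤ ENNReal.ofReal M := by
  refine iSup₂_le fun a ha => ?_
  obtain ⟨t, ht⟩ := hK a ha
  have h := hM _ ht
  rw [map_sub, map_smul, map_sub, map_smul, φ.2.2, ψ.2.2, sub_sub_sub_cancel_right] at h
  rw [← ofReal_norm]
  exact ENNReal.ofReal_le_ofReal h

/-- The Monge-Kantorovich distance bounds the oscillation of each element of the domain. -/
theorem norm_sub_le_mongeKantorovich (hsmul : ∀ (t : ℝ) (a : selfAdjoint B), L (t • a) = ‖t‖ₑ * L a)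
    {φ ψ : stateSpace B} (hfin : mongeKantorovich L φ ψ ≠ ∞) {a : selfAdjoint B} {c : ℝ}
    (hc : 0 < c) (ha : L a ≤ ENNReal.ofReal c) :
    ‖φ.1 (a : B) - ψ.1 (a : B)‖ ≤ c * (mongeKantorovich L φ ψ).toReal := by
  have h1 : L (c⁻¹ • a) ≤ 1 := by
    rw [hsmul, Real.enorm_of_nonneg (inv_nonneg.2 hc.le), ENNReal.ofReal_inv_of_pos hc]
    refine (mul_le_mul_right ha _).trans ?_
    rw [ENNReal.inv_mul_cancel (by simpa using hc) ENNReal.ofReal_ne_top]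
  have h2 : ‖φ.1 ((c⁻¹ • a : selfAdjoint B) : B) - ψ.1 ((c⁻¹ • a : selfAdjoint B) : B)‖ₑ
      ≤ mongeKantorovich L φ ψ :=
    le_iSup₂ (f := fun (a : selfAdjoint B) (_ : L a ≤ 1) => ‖φ.1 (a : B) - ψ.1 (a : B)‖ₑ) _ h1
  have h3 : ((c⁻¹ • a : selfAdjoint B) : B) = ((c⁻¹ : ℝ) : ℂ) • (a : B) := by
    rw [selfAdjoint.val_smul]; norm_cast
  rw [h3, map_smul, map_smul, ← smul_sub] at h2
  have h4 := ENNReal.toReal_mono hfin h2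
  rw [toReal_enorm, norm_smul, Complex.norm_real, Real.norm_of_nonneg (inv_nonneg.2 hc.le)] at h4
  rwa [inv_mul_le_iff₀ hc] at h4

theorem eq_of_forall_selfAdjoint {φ ψ : stateSpace B}
    (h : ∀ a : selfAdjoint B, φ.1 (a : B) = ψ.1 (a : B)) : φ = ψ := by
  refine Subtype.ext (DFunLike.ext _ _ fun a => ?_)
  rw [← realPart_add_I_smul_imaginaryPart a, map_add, map_add, map_smul, map_smul, h, h]

/-- If the unit ball of `L` is totally bounded modulo the scalars, then the Monge-Kantorovich
distance metrizes the weak* topology of the state space. -/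
theorem metrizes_of_totallyBounded
    (hsmul : ∀ (t : ℝ) (a : selfAdjoint B), L (t • a) = ‖t‖ₑ * L a)
    (hdense : Dense {a : selfAdjoint B | L a < ∞}) {K : Set B} (hKt : TotallyBounded K)
    (hK : ∀ a : selfAdjoint B, L a ≤ 1 → ∃ t : ℝ, (a : B) - (t : ℂ) • (1 : B) ∈ K) :
    ∃ m : MetricSpace (stateSpace B),
      (∀ φ ψ : stateSpace B, mongeKantorovich L φ ψ = ENNReal.ofReal (m.dist φ ψ)) ∧
      m.toUniformSpace.toTopologicalSpace = weakStarTopology B := by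
  have hfin : ∀ φ ψ : stateSpace B, mongeKantorovich L φ ψ ≠ ∞ := by
    intro φ ψ
    obtain ⟨C, hC⟩ := hKt.isBounded.exists_norm_le
    refine ne_top_of_le_ne_top ENNReal.ofReal_ne_top
      (mongeKantorovich_le (M := 2 * C + 2 * C) hK fun k hk => (norm_sub_le _ _).trans ?_)
    have := hC k hk
    linarith [stateSpace.norm_apply_le φ k, stateSpace.norm_apply_le ψ k]
  -- Elements of the domain are Lipschitz on states; by density every self-adjoint element is
  -- uniformly continuous. This yields both separation of states and one comparison of topologies.
  have hosc : ∀ a : selfAdjoint B, ∀ ε > 0, ∃ δ > 0, ∀ φ ψ : stateSpace B,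
      (mongeKantorovich L φ ψ).toReal < δ → ‖φ.1 (a : B) - ψ.1 (a : B)‖ < ε := by
    intro a ε hε
    obtain ⟨b, hb, hab⟩ := Metric.dense_iff.1 hdense a (ε / 4) (by positivity)
    have hbpos : 0 < (L b).toReal + 1 := by positivity
    refine ⟨ε / 2 / ((L b).toReal + 1), by positivity, fun φ ψ h => ?_⟩
    have h1 : ‖φ.1 (b : B) - ψ.1 (b : B)‖ ≤ ((L b).toReal + 1) * (mongeKantorovich L φ ψ).toReal := by
      refine norm_sub_le_mongeKantorovich hsmul (hfin φ ψ) hbpos ?_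
      rw [← ENNReal.ofReal_toReal (ne_of_lt hab)]
      exact ENNReal.ofReal_le_ofReal (by simp)
    have h2 : ((L b).toReal + 1) * (mongeKantorovich L φ ψ).toReal < ε / 2 := by
      rwa [lt_div_iff₀ hbpos, mul_comm] at h
    have h3 : ‖((a - b : selfAdjoint B) : B)‖ < ε / 4 := by
      rw [Metric.mem_ball, dist_comm, dist_eq_norm] at hb
      exact hb
    have h4 := stateSpace.norm_apply_sa_le φ (a - b).2
    have h5 := stateSpace.norm_apply_sa_le ψ (a - b).2
    have h6 : φ.1 (a : B) - ψ.1 (a : B) = (φ.1 (b : B) - ψ.1 (b : B))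
        + (φ.1 ((a - b : selfAdjoint B) : B) - ψ.1 ((a - b : selfAdjoint B) : B)) := by
      rw [AddSubgroup.coe_sub, map_sub, map_sub]; ring
    rw [h6]
    refine (norm_add_le _ _).trans_lt ?_
    have h7 := norm_sub_le (φ.1 ((a - b : selfAdjoint B) : B)) (ψ.1 ((a - b : selfAdjoint B) : B))
    linarith
  obtain ⟨m, hm⟩ : ∃ m : MetricSpace (stateSpace B),
      ∀ φ ψ, m.dist φ ψ = (mongeKantorovich L φ ψ).toReal := ⟨
    { dist := fun φ ψ => (mongeKantorovich L φ ψ).toReal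
      dist_self := fun φ => by simp [mongeKantorovich]
      dist_comm := fun φ ψ => by rw [mongeKantorovich_comm]
      dist_triangle := fun φ ψ χ => by
        rw [← ENNReal.toReal_add (hfin _ _) (hfin _ _)]
        exact ENNReal.toReal_mono (ENNReal.add_ne_top.2 ⟨hfin _ _, hfin _ _⟩)
          (mongeKantorovich_triangle L φ ψ χ)
      eq_of_dist_eq_zero := fun {φ ψ} h => eq_of_forall_selfAdjoint fun a => by
        by_contra hne
        obtain ⟨δ, hδ, H⟩ := hosc a _ (norm_pos_iff.2 (sub_ne_zero.2 hne))
        exact lt_irrefl _ (H φ ψ (lt_of_eq_of_lt h hδ)) },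
    fun _ _ => rfl⟩
  refine ⟨m, fun φ ψ => hm φ ψ ▸ (ENNReal.ofReal_toReal (hfin φ ψ)).symm, le_antisymm ?_ ?_⟩
  · rw [← continuous_iff_le_induced]
    refine @continuous_of_continuous_eval_selfAdjoint B _ _ m.toUniformSpace.toTopologicalSpace _
      fun b => Metric.continuous_iff.2 fun φ ε hε => ?_
    obtain ⟨δ, hδ, H⟩ := hosc b ε hε
    exact ⟨δ, hδ, fun ψ hψ => by
      rw [dist_eq_norm]
      exact H ψ φ ((hm ψ φ).symm.trans_lt hψ)⟩
  · refine topologicalSpace_le_of_eventually_dist_lt _ m fun φ ε hε => ?_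
    -- Two states, each bounded by 2, differ by at most `4 * (ε / 16)` on `k - s`; with `ε / 4` on
    -- the net the total is `ε / 2`.
    obtain ⟨T, hT, hKT⟩ := Metric.totallyBounded_iff.1 hKt (ε / 16) (by positivity)
    have hev : ∀ᶠ ψ in @nhds _ (weakStarTopology B) φ, ∀ s ∈ T, ‖ψ.1 s - φ.1 s‖ < ε / 4 := by
      refine (eventually_all_finite hT).2 fun s _ => ?_
      have hc : Continuous fun ψ : stateSpace B => ‖ψ.1 s - φ.1 s‖ :=
        (((WeakDual.eval_continuous s).comp continuous_subtype_val).sub continuous_const).norm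
      exact hc.continuousAt.eventually_lt continuousAt_const (by simpa using by positivity)
    filter_upwards [hev] with ψ hψ
    rw [hm]
    have hle : mongeKantorovich L ψ φ ≤ ENNReal.ofReal (ε / 2) := by
      refine mongeKantorovich_le hK fun k hk => ?_
      obtain ⟨s, hs, hks⟩ := Set.mem_iUnion₂.1 (hKT hk)
      rw [Metric.mem_ball, dist_eq_norm] at hks
      have h6 : ψ.1 k - φ.1 k = (ψ.1 s - φ.1 s) + (ψ.1 (k - s) - φ.1 (k - s)) := by
        rw [map_sub, map_sub]; ring
      rw [h6]
      refine (norm_add_le _ _).trans ?_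
      have h7 := norm_sub_le (ψ.1 (k - s)) (φ.1 (k - s))
      linarith [stateSpace.norm_apply_le φ (k - s), stateSpace.norm_apply_le ψ (k - s), hψ s hs]
    have := ENNReal.toReal_le_of_le_ofReal (by positivity) hle
    linarith

end Metrization

/-! ### Lipschitz functions: Leibniz rule, density, Arzelà–Ascoli -/

section Lipschitz

variable {X : Type*} [MetricSpace X] [CompactSpace X] {A : Type*} [CStarAlgebra A]

theorem lipConst_le_iff {f : C(X, A)} {c : ℝ≥0∞} :
    lipConst f ≤ c ↔ ∀ x y, ‖f x - f y‖ₑ ≤ c * edist x y := by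
  simp only [lipConst, iSup_le_iff]
  refine forall₂_congr fun x y => ?_
  rcases eq_or_ne x y with rfl | h
  · simp
  · exact ENNReal.div_le_iff_le_mul (Or.inl (by simpa using h)) (Or.inl (edist_ne_top x y))

theorem enorm_sub_le_lipConst (f : C(X, A)) (x y : X) :
    ‖f x - f y‖ₑ ≤ lipConst f * edist x y :=
  lipConst_le_iff.1 le_rfl x y

theorem enorm_apply_le (f : C(X, A)) (x : X) : ‖f x‖ₑ ≤ ‖f‖ₑ :=
  enorm_le_iff_norm_le.2 (f.norm_coe_le_norm x)

theorem lipConst_add_le (f g : C(X, A)) : lipConst (f + g) ≤ lipConst f + lipConst g := by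
  refine lipConst_le_iff.2 fun x y => ?_
  have h : (f + g) x - (f + g) y = (f x - f y) + (g x - g y) := by
    simp only [ContinuousMap.add_apply]; abel
  rw [h, add_mul]
  exact (enorm_add_le _ _).trans
    (add_le_add (enorm_sub_le_lipConst f x y) (enorm_sub_le_lipConst g x y))

theorem lipConst_smul (c : ℂ) (f : C(X, A)) : lipConst (c • f) = ‖c‖ₑ * lipConst f := by
  simp only [lipConst, ContinuousMap.smul_apply, ← smul_sub, enorm_smul, ENNReal.mul_iSup,
    mul_div_assoc]

theorem lipConst_neg (f : C(X, A)) : lipConst (-f) = lipConst f := by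
  have := lipConst_smul (-1) f
  simpa using this

theorem lipConst_star (f : C(X, A)) : lipConst (star f) = lipConst f := by
  simp only [lipConst, ContinuousMap.star_apply, ← star_sub, ← ofReal_norm, norm_star]

theorem lipConst_const (a : A) : lipConst (ContinuousMap.const X a) = 0 := by
  simp [lipConst]

theorem lipConst_sub_const (f : C(X, A)) (a : A) :
    lipConst (f - ContinuousMap.const X a) = lipConst f := by
  simp [lipConst]

theorem enorm_mul_le_mul (a b : A) : ‖a * b‖ₑ ≤ ‖a‖ₑ * ‖b‖ₑ := by
  rw [← ofReal_norm, ← ofReal_norm, ← ofReal_norm, ← ENNReal.ofReal_mul (norm_nonneg _)]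
  exact ENNReal.ofReal_le_ofReal (norm_mul_le a b)

theorem lipConst_mul_le (f g : C(X, A)) :
    lipConst (f * g) ≤ lipConst f * ‖g‖ₑ + lipConst g * ‖f‖ₑ := by
  refine lipConst_le_iff.2 fun x y => ?_
  have h : (f * g) x - (f * g) y = (f x - f y) * g x + f y * (g x - g y) := by
    simp only [ContinuousMap.mul_apply, sub_mul, mul_sub]; abel
  rw [h]
  calc _ ≤ ‖f x - f y‖ₑ * ‖g x‖ₑ + ‖f y‖ₑ * ‖g x - g y‖ₑ :=
        (enorm_add_le _ _).trans (add_le_add (enorm_mul_le_mul _ _) (enorm_mul_le_mul _ _))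
    _ ≤ (lipConst f * edist x y) * ‖g‖ₑ + ‖f‖ₑ * (lipConst g * edist x y) := by
        gcongr
        · exact enorm_sub_le_lipConst f x y
        · exact enorm_apply_le g x
        · exact enorm_apply_le f y
        · exact enorm_sub_le_lipConst g x y
    _ = _ := by ring

theorem eq_const_of_lipConst_eq_zero {f : C(X, A)} (h : lipConst f = 0) (x y : X) :
    f x = f y := by
  have := enorm_sub_le_lipConst f x y
  rw [h, zero_mul, nonpos_iff_eq_zero, enorm_eq_zero] at this
  exact sub_eq_zero.1 this

theorem lowerSemicontinuous_lipConst : LowerSemicontinuous (lipConst : C(X, A) → ℝ≥0∞) := by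
  refine lowerSemicontinuous_iSup fun x => lowerSemicontinuous_iSup fun y => ?_
  refine Continuous.lowerSemicontinuous ?_
  rcases eq_or_ne x y with rfl | h
  · simpa using continuous_const
  · refine (ENNReal.continuous_div_const _ (by simpa using h)).comp ?_
    exact ((continuous_eval_const x).sub
      (continuous_eval_const y)).enorm

variable (X) in
/-- The Lipschitz functions `X → ℂ`, as a star subalgebra of `C(X, ℂ)`. -/
def lipschitzStarSubalgebra : StarSubalgebra ℂ C(X, ℂ) where
  carrier := {f | lipConst f < ∞}
  mul_mem' := fun {f g} hf hg => (lipConst_mul_le f g).trans_lt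
    (ENNReal.add_lt_top.2 ⟨ENNReal.mul_lt_top hf enorm_lt_top, ENNReal.mul_lt_top hg enorm_lt_top⟩)
  add_mem' := fun {f g} hf hg => (lipConst_add_le f g).trans_lt (ENNReal.add_lt_top.2 ⟨hf, hg⟩)
  algebraMap_mem' := fun c => by
    have : algebraMap ℂ C(X, ℂ) c = ContinuousMap.const X c := rfl
    simp [this, lipConst_const]
  star_mem' := fun {f} hf => by simpa [lipConst_star] using hf

theorem separatesPoints_lipschitzStarSubalgebra :
    (lipschitzStarSubalgebra X).SeparatesPoints := by
  intro x y hxy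
  refine ⟨_, ⟨⟨fun z => ((dist z x : ℝ) : ℂ), by fun_prop⟩, ?_, rfl⟩, ?_⟩
  · refine (lipConst_le_iff.2 fun z w => ?_ : _ ≤ (1 : ℝ≥0∞)).trans_lt ENNReal.one_lt_top
    rw [one_mul, ContinuousMap.coe_mk, ← Complex.ofReal_sub, edist_dist, ← ofReal_norm,
      Complex.norm_real]
    exact ENNReal.ofReal_le_ofReal (abs_dist_sub_le z w x)
  · exact fun h => hxy (by simpa [eq_comm] using h)

variable (X A) in
/-- The Lipschitz functions `X → A`, as a subspace of `C(X, A)`. -/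
def lipschitzSubmodule : Submodule ℂ C(X, A) where
  carrier := {f | lipConst f < ∞}
  add_mem' := fun {f g} hf hg => (lipConst_add_le f g).trans_lt (ENNReal.add_lt_top.2 ⟨hf, hg⟩)
  zero_mem' := by
    have : (0 : C(X, A)) = ContinuousMap.const X 0 := rfl
    rw [this, Set.mem_ofPred_eq, lipConst_const]
    exact ENNReal.zero_lt_top
  smul_mem' := fun c f hf => by
    rw [Set.mem_ofPred_eq, lipConst_smul]
    exact ENNReal.mul_lt_top enorm_lt_top hf

/-- Stone–Weierstrass handles scalar functions; a finite basis of `A` reduces the general case to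
coordinates. -/
theorem dense_lipschitzSubmodule [FiniteDimensional ℂ A] :
    Dense (lipschitzSubmodule X A : Set C(X, A)) := by
  rw [Submodule.dense_iff_topologicalClosure_eq_top, eq_top_iff]
  intro f _
  let e := Module.finBasis ℂ A
  let m : A → C(ℂ, A) := fun a => ⟨fun z => z • a, by fun_prop⟩
  have hmem : ∀ (g : C(X, ℂ)) (a : A),
      (m a).comp g ∈ (lipschitzSubmodule X A).topologicalClosure := by
    intro g a
    have hg : g ∈ (lipschitzStarSubalgebra X).topologicalClosure := by
      rw [ContinuousMap.starSubalgebra_topologicalClosure_eq_top_of_separatesPoints _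
        separatesPoints_lipschitzStarSubalgebra]
      trivial
    refine map_mem_closure (ContinuousMap.continuous_postcomp (m a)) hg fun p hp => ?_
    refine (lipConst_le_iff.2 fun x y => ?_ : _ ≤ lipConst p * ‖a‖ₑ).trans_lt
      (ENNReal.mul_lt_top hp enorm_lt_top)
    have : (m a).comp p x - (m a).comp p y = (p x - p y) • a := by
      rw [sub_smul]; rfl
    rw [this, enorm_smul, mul_right_comm]
    exact mul_le_mul_left (enorm_sub_le_lipConst p x y) _
  have hf : f = ∑ i, (m (e i)).comp ⟨fun x => e.coord i (f x),
      (LinearMap.continuous_of_finiteDimensional (e.coord i)).comp f.continuous⟩ := by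
    ext x
    rw [ContinuousMap.sum_apply]
    exact (e.sum_repr (f x)).symm
  rw [hf]
  exact Submodule.sum_mem _ fun i _ => hmem _ _

/-- All values lie in the ball of radius `r + diam X`, compact because `A` is proper, so
Arzelà–Ascoli applies. -/
theorem totallyBounded_setOf_lipConst_le_one [FiniteDimensional ℂ A] (x₀ : X) (r : ℝ) :
    TotallyBounded {f : C(X, A) | ‖f x₀‖ ≤ r ∧ lipConst f ≤ 1} := by
  have : ProperSpace A := FiniteDimensional.proper ℂ A
  have hiso := ContinuousMap.isometryEquivBoundedOfCompact X A |>.isometry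
  rw [← totallyBounded_image_iff hiso.isUniformInducing]
  refine (BoundedContinuousFunction.arzela_ascoli
    (Metric.closedBall 0 (r + Metric.diam (Set.univ : Set X))) (isCompact_closedBall _ _) _ ?_ ?_
      ).totallyBounded.subset subset_closure
  · rintro _ x ⟨f, ⟨hf, hf'⟩, rfl⟩
    have h := (enorm_sub_le_lipConst f x x₀).trans (mul_le_mul_left hf' _)
    rw [one_mul, edist_dist, ← ofReal_norm, ENNReal.ofReal_le_ofReal_iff dist_nonneg] at h
    have h1 := Metric.dist_le_diam_of_mem isCompact_univ.isBounded (Set.mem_univ x)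
      (Set.mem_univ x₀)
    rw [mem_closedBall_zero_iff]
    change ‖f x‖ ≤ _
    have h2 := norm_le_norm_add_norm_sub (f x₀) (f x)
    rw [norm_sub_rev] at h2
    linarith
  · refine (LipschitzWith.uniformEquicontinuous _ 1 ?_).equicontinuous
    rintro ⟨_, f, ⟨hf, hf'⟩, rfl⟩ x y
    have h := (enorm_sub_le_lipConst f x y).trans (mul_le_mul_left hf' _)
    rw [edist_eq_enorm_sub]
    simpa using h

end Lipschitz

/-! ### The seminorm on functions over a finite-dimensional algebra -/

section LipNorm

variable {X : Type*} [MetricSpace X] [CompactSpace X] {A : Type*} [CStarAlgebra A]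
  {E : C(X, A) →ₗ[ℂ] scalarFunctions X A} {r : ℝ}

/-- The map `id - E` kills `b` and has norm at most 2. This is the source of the quasi-Leibniz
constant. -/
theorem norm_sub_apply_le (hE : IsConditionalExpectation E) (f : C(X, A))
    (b : scalarFunctions X A) : ‖f - (E f : C(X, A))‖ ≤ 2 * ‖f - b‖ := by
  have h : f - (E f : C(X, A)) = (f - b) - (E (f - b) : C(X, A)) := by
    rw [map_sub, hE.apply_coe]; simp
  have h1 : ‖(E (f - b) : C(X, A))‖ ≤ ‖f - b‖ := hE.contractive _
  rw [h]
  linarith [norm_sub_le (f - (b : C(X, A))) (E (f - b) : C(X, A))]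

/-- The product `E f * E g` serves as a scalar approximant of `f * g`, which avoids any
multiplicative property of `E`. -/
theorem norm_mul_sub_le (hE : IsConditionalExpectation E) (f g : C(X, A)) :
    ‖f * g - (E f * E g : C(X, A))‖ ≤
      ‖f - (E f : C(X, A))‖ * ‖g‖ + ‖g - (E g : C(X, A))‖ * ‖f‖ := by
  have h : f * g - (E f * E g : C(X, A)) = (f - E f) * g + E f * (g - E g) := by
    rw [sub_mul, mul_sub]; abel
  have h1 : ‖(E f : C(X, A))‖ ≤ ‖f‖ := hE.contractive _
  rw [h]
  refine (norm_add_le _ _).trans (add_le_add (norm_mul_le _ _) ((norm_mul_le _ _).trans ?_))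
  rw [mul_comm]
  gcongr

theorem scalarFunctions_mul_comm (f g : scalarFunctions X A) :
    (f * g : C(X, A)) = (g * f : C(X, A)) := by
  ext x
  obtain ⟨c, hc⟩ := f.2 x
  obtain ⟨d, hd⟩ := g.2 x
  simp [hc, hd, smul_smul, mul_comm]

theorem enorm_sub_apply_le_of_norm_le (hE : IsConditionalExpectation E) {f g h : C(X, A)}
    {b : scalarFunctions X A}
    (hb : ‖h - b‖ ≤ ‖f - (E f : C(X, A))‖ * ‖g‖ + ‖g - (E g : C(X, A))‖ * ‖f‖) :
    ‖h - (E h : C(X, A))‖ₑ ≤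
      2 * (‖f - (E f : C(X, A))‖ₑ * ‖g‖ₑ + ‖g - (E g : C(X, A))‖ₑ * ‖f‖ₑ) := by
  have h1 := (norm_sub_apply_le hE h b).trans (mul_le_mul_of_nonneg_left hb zero_le_two)
  have h2 := ENNReal.ofReal_le_ofReal h1
  rw [ENNReal.ofReal_mul zero_le_two, ENNReal.ofReal_add (by positivity) (by positivity),
    ENNReal.ofReal_mul (norm_nonneg _), ENNReal.ofReal_mul (norm_nonneg _)] at h2
  simpa only [ofReal_norm, ENNReal.ofReal_ofNat] using h2

theorem lipNorm_le_of_le {f g h : selfAdjoint C(X, A)}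
    (h1 : lipConst (h : C(X, A)) ≤
      lipConst (f : C(X, A)) * ‖(g : C(X, A))‖ₑ + lipConst (g : C(X, A)) * ‖(f : C(X, A))‖ₑ)
    (h2 : ‖(h : C(X, A)) - (E h : C(X, A))‖ₑ ≤
      2 * (‖(f : C(X, A)) - (E f : C(X, A))‖ₑ * ‖(g : C(X, A))‖ₑ +
        ‖(g : C(X, A)) - (E g : C(X, A))‖ₑ * ‖(f : C(X, A))‖ₑ)) :
    lipNorm E r h ≤ (2 : ℝ≥0) * (lipNorm E r f * ‖(g : C(X, A))‖ₑ +
      lipNorm E r g * ‖(f : C(X, A))‖ₑ) := by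
  simp only [lipNorm, ENNReal.coe_ofNat, div_eq_mul_inv]
  calc _ ≤ 2 * (lipConst (f : C(X, A)) * ‖(g : C(X, A))‖ₑ +
        lipConst (g : C(X, A)) * ‖(f : C(X, A))‖ₑ) + _ :=
        add_le_add (h1.trans (le_mul_of_one_le_left' one_le_two)) (mul_le_mul_left h2 _)
    _ = _ := by ring

theorem lipConst_smul_add_le {c : ℂ} (hc : ‖c‖ = 2⁻¹) {f g : C(X, A)} {T : ℝ≥0∞}
    (hf : lipConst f ≤ T) (hg : lipConst g ≤ T) : lipConst (c • (f + g)) ≤ T := by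
  have e : ‖c‖ₑ = 2⁻¹ := by
    rw [← ofReal_norm, hc, ENNReal.ofReal_inv_of_pos two_pos]; simp
  rw [lipConst_smul, e]
  refine (mul_le_mul_right ((lipConst_add_le f g).trans (add_le_add hf hg)) _).trans ?_
  rw [← two_mul, ← mul_assoc, ENNReal.inv_mul_cancel two_ne_zero ENNReal.ofNat_ne_top, one_mul]

theorem norm_smul_add_le {c : ℂ} (hc : ‖c‖ = 2⁻¹) {f g : C(X, A)} {T : ℝ}
    (hf : ‖f‖ ≤ T) (hg : ‖g‖ ≤ T) : ‖c • (f + g)‖ ≤ T := by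
  rw [norm_smul, hc]
  linarith [norm_add_le f g]

theorem isQuasiLeibniz_lipNorm (hE : IsConditionalExpectation E) :
    IsQuasiLeibniz 2 (lipNorm E r) := by
  refine ⟨one_le_two, fun a b => ?_⟩
  obtain ⟨f, hf⟩ : ∃ f : C(X, A), f = a := ⟨_, rfl⟩
  obtain ⟨g, hg⟩ : ∃ g : C(X, A), g = b := ⟨_, rfl⟩
  have hj : (jordanProd a b : C(X, A)) = (2 : ℂ)⁻¹ • (f * g + g * f) := by
    rw [hf, hg]; rfl
  have hl : (lieProd a b : C(X, A)) = (2 * Complex.I : ℂ)⁻¹ • (f * g - g * f) := by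
    rw [hf, hg]; rfl
  have h2 : ‖(2 : ℂ)⁻¹‖ = 2⁻¹ := by simp
  have h2I : ‖(2 * Complex.I : ℂ)⁻¹‖ = 2⁻¹ := by simp
  have hfg := lipConst_mul_le f g
  have hgf := lipConst_mul_le g f
  rw [add_comm] at hgf
  have nfg := norm_mul_sub_le hE f g
  have ngf := norm_mul_sub_le hE g f
  rw [add_comm, scalarFunctions_mul_comm] at ngf
  constructor
  · refine lipNorm_le_of_le ?_ (enorm_sub_apply_le_of_norm_le hE (b := E f * E g) ?_)
    · rw [hj, ← hf, ← hg]
      exact lipConst_smul_add_le h2 hfg hgf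
    · rw [hj, ← hf, ← hg]
      have : (2 : ℂ)⁻¹ • (f * g + g * f) - (E f * E g : C(X, A)) =
          (2 : ℂ)⁻¹ • ((f * g - (E f * E g : C(X, A))) + (g * f - (E f * E g : C(X, A)))) := by
        module
      exact (congrArg norm this).trans_le (norm_smul_add_le h2 nfg ngf)
  -- Scalar functions commute, so the approximants of `f * g` and `g * f` cancel in the commutator.
  · refine lipNorm_le_of_le ?_ (enorm_sub_apply_le_of_norm_le hE (b := 0) ?_)
    · rw [hl, ← hf, ← hg, sub_eq_add_neg]
      exact lipConst_smul_add_le h2I hfg (by rwa [lipConst_neg])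
    · rw [hl, ← hf, ← hg]
      have : (2 * Complex.I : ℂ)⁻¹ • (f * g - g * f) - (0 : C(X, A)) =
          (2 * Complex.I : ℂ)⁻¹ • ((f * g - (E f * E g : C(X, A))) +
            -(g * f - (E f * E g : C(X, A)))) := by
        module
      exact (congrArg norm this).trans_le (norm_smul_add_le h2I nfg (by rwa [norm_neg]))

theorem lipNorm_add_le (f g : selfAdjoint C(X, A)) :
    lipNorm E r (f + g) ≤ lipNorm E r f + lipNorm E r g := by
  simp only [lipNorm, map_add, AddMemClass.coe_add, add_sub_add_comm]
  calc _ ≤ (lipConst (f : C(X, A)) + lipConst (g : C(X, A))) +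
        (‖(f : C(X, A)) - (E f : C(X, A))‖ₑ + ‖(g : C(X, A)) - (E g : C(X, A))‖ₑ) /
          ENNReal.ofReal r := by
        gcongr
        · exact lipConst_add_le _ _
        · exact enorm_add_le _ _
    _ = _ := by rw [ENNReal.add_div]; abel

theorem lipNorm_smul (t : ℝ) (f : selfAdjoint C(X, A)) :
    lipNorm E r (t • f) = ‖t‖ₑ * lipNorm E r f := by
  have h : ((t • f : selfAdjoint C(X, A)) : C(X, A)) = (t : ℂ) • (f : C(X, A)) := by
    ext x
    simp
  have ht : ‖(t : ℂ)‖ₑ = ‖t‖ₑ := by rw [← ofReal_norm, Complex.norm_real, ofReal_norm]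
  simp only [lipNorm, h, map_smul, SetLike.val_smul, ← smul_sub, enorm_smul, lipConst_smul,
    ht, mul_add, mul_div_assoc]

theorem lipNorm_eq_zero_iff [Nonempty X] (hE : IsConditionalExpectation E)
    {f : selfAdjoint C(X, A)} :
    lipNorm E r f = 0 ↔ ∃ t : ℝ, f = t • (1 : selfAdjoint C(X, A)) := by
  constructor
  · intro h
    obtain ⟨h1, h2⟩ := add_eq_zero.1 h
    rw [ENNReal.div_eq_zero_iff, or_iff_left ENNReal.ofReal_ne_top, enorm_eq_zero, sub_eq_zero] at h2
    obtain ⟨x₀⟩ := ‹Nonempty X›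
    obtain ⟨c, hc⟩ := (E f).2 x₀
    rw [← h2] at hc
    refine ⟨c.re, Subtype.ext (ContinuousMap.ext fun x => ?_)⟩
    rw [eq_const_of_lipConst_eq_zero h1 x x₀]
    have hs : star ((f : C(X, A)) x₀) = (f : C(X, A)) x₀ := by
      rw [← ContinuousMap.star_apply, selfAdjoint.star_val_eq]
    rw [hc, star_smul, star_one] at hs
    -- In the zero algebra `c` need not be real, so only the multiples of `1` are compared.
    have : (c.re : ℂ) • (1 : A) = c • (1 : A) := by
      have h3 : (c.re : ℂ) = (2 : ℂ)⁻¹ * (star c + c) := by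
        rw [Complex.star_def, add_comm, Complex.add_conj]; push_cast; ring
      rw [h3, mul_smul, add_smul, hs, ← two_smul ℂ, smul_smul, inv_mul_cancel₀ two_ne_zero, one_smul]
    rw [hc, ← this]
    simp
  · rintro ⟨t, rfl⟩
    have h1 : E 1 = 1 := hE.apply_coe 1
    have h2 : (1 : C(X, A)) = ContinuousMap.const X 1 := rfl
    have h3 : lipConst (1 : C(X, A)) = 0 := by rw [h2, lipConst_const]
    rw [lipNorm_smul]
    simp [lipNorm, h1, h3]

theorem continuous_coe_conditionalExpectation (hE : IsConditionalExpectation E) :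
    Continuous fun f => (E f : C(X, A)) :=
  continuous_subtype_val.comp
    (AddMonoidHomClass.continuous_of_bound E 1 fun f => by simpa using hE.contractive f)

theorem lowerSemicontinuous_lipNorm (hE : IsConditionalExpectation E) (hr : 0 < r) :
    LowerSemicontinuous (lipNorm E r) := by
  refine LowerSemicontinuous.add (lowerSemicontinuous_lipConst.comp continuous_subtype_val) ?_
  refine Continuous.lowerSemicontinuous ?_
  refine (ENNReal.continuous_div_const _ (by simpa using hr)).comp ?_
  exact (continuous_subtype_val.sub
    ((continuous_coe_conditionalExpectation hE).comp continuous_subtype_val)).enorm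

/-- The real part is a continuous surjection onto the self-adjoint functions and preserves Lipschitz
functions; the other term of `lipNorm` is always finite. -/
theorem dense_lipNorm_lt_top [FiniteDimensional ℂ A] (hr : 0 < r) :
    Dense {f : selfAdjoint C(X, A) | lipNorm E r f < ∞} := by
  have hc : Continuous (realPart : C(X, A) → selfAdjoint C(X, A)) :=
    AddMonoidHomClass.continuous_of_bound realPart 1 fun f => by simpa using realPart.norm_le f
  have hs : DenseRange (realPart : C(X, A) → selfAdjoint C(X, A)) :=
    Function.Surjective.denseRange fun f => ⟨f, Subtype.ext f.2.coe_realPart⟩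
  refine (hs.dense_image hc dense_lipschitzSubmodule).mono ?_
  rintro _ ⟨f, hf, rfl⟩
  refine ENNReal.add_lt_top.2 ⟨?_, ENNReal.div_lt_top enorm_ne_top (by simpa using hr)⟩
  rw [realPart_apply_coe]
  have : ((2 : ℝ)⁻¹ • (f + star f) : C(X, A)) = ((2 : ℂ)⁻¹) • (f + star f) := by
    ext x; simp [← Complex.coe_smul]
  rw [this, lipConst_smul]
  refine ENNReal.mul_lt_top enorm_lt_top ((lipConst_add_le _ _).trans_lt ?_)
  rw [lipConst_star]
  exact ENNReal.add_lt_top.2 ⟨hf, hf⟩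

theorem exists_sub_smul_one_mem (hr : 0 < r) (x₀ : X) {f : selfAdjoint C(X, A)}
    (hf : lipNorm E r f ≤ 1) :
    ∃ t : ℝ, (f : C(X, A)) - (t : ℂ) • (1 : C(X, A)) ∈
      {f : C(X, A) | ‖f x₀‖ ≤ r ∧ lipConst f ≤ 1} := by
  obtain ⟨c, hc⟩ := (E f).2 x₀
  refine ⟨c.re, ?_, ?_⟩
  · have h1 : ‖(f : C(X, A)) - (E f : C(X, A))‖ₑ ≤ ENNReal.ofReal r := by
      have := le_add_self.trans hf
      rwa [ENNReal.div_le_iff (by simpa using hr) ENNReal.ofReal_ne_top, one_mul] at this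
    rw [← ofReal_norm, ENNReal.ofReal_le_ofReal_iff hr.le] at h1
    have h2 := (ContinuousMap.norm_coe_le_norm _ x₀).trans h1
    rw [ContinuousMap.sub_apply, hc] at h2
    -- The scalar `c` may be complex; taking real parts is contractive and turns `f x₀ - c` into `f
    -- x₀ - c.re`.
    refine le_trans ?_ ((realPart.norm_le _).trans h2)
    have hs : IsSelfAdjoint ((f : C(X, A)) x₀) := by
      rw [IsSelfAdjoint, ← ContinuousMap.star_apply, selfAdjoint.star_val_eq]
    have h3 : ((f : C(X, A)) - (c.re : ℂ) • (1 : C(X, A))) x₀ =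
        (realPart ((f : C(X, A)) x₀ - c • (1 : A)) : A) := by
      rw [map_sub, AddSubgroup.coe_sub, hs.coe_realPart, realPart_smul]
      simp [(IsSelfAdjoint.one A).imaginaryPart]
    rw [h3, AddSubgroup.norm_coe]
  · have : (f : C(X, A)) - (c.re : ℂ) • (1 : C(X, A)) =
      f - ContinuousMap.const X ((c.re : ℂ) • (1 : A)) := by ext x; simp
    rw [this, lipConst_sub_const]
    exact le_self_add.trans hf

theorem isQuasiLeibnizCQMS_lipNorm [Nonempty X] [FiniteDimensional ℂ A]
    (hE : IsConditionalExpectation E) (hr : 0 < r) : IsQuasiLeibnizCQMS 2 (lipNorm E r) := by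
  obtain ⟨x₀⟩ := ‹Nonempty X›
  have : Nonempty X := ⟨x₀⟩
  refine ⟨⟨lipNorm_add_le, lipNorm_smul, ?_, dense_lipNorm_lt_top hr, ?_, ?_,
    lowerSemicontinuous_lipNorm hE hr⟩, isQuasiLeibniz_lipNorm hE⟩
  · rw [(lipNorm_eq_zero_iff hE).2 ⟨1, (one_smul ℝ _).symm⟩]
    exact ENNReal.zero_lt_top
  · ext f
    exact lipNorm_eq_zero_iff hE
  · exact metrizes_of_totallyBounded lipNorm_smul (dense_lipNorm_lt_top hr)
      (totallyBounded_setOf_lipConst_le_one x₀ r) fun f hf => exists_sub_smul_one_mem hr x₀ hf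

end LipNorm

/-! ### Finite dimension from compactness of the state space -/

section FiniteDimension

/-- An equi-Lipschitz bounded sequence of functions on a compact space has two terms that are
uniformly close. -/
theorem exists_ne_forall_norm_sub_lt {S : Type*} [MetricSpace S] [CompactSpace S]
    (F : ℕ → S → ℂ) {C : ℝ≥0} {ρ ε : ℝ} (hε : 0 < ε) (hlip : ∀ n, LipschitzWith C (F n))
    (hb : ∀ n s, ‖F n s‖ ≤ ρ) : ∃ m n, m ≠ n ∧ ∀ s, ‖F m s - F n s‖ < ε := by
  let G : ℕ → BoundedContinuousFunction S ℂ := fun n =>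
    BoundedContinuousFunction.mkOfCompact ⟨F n, (hlip n).continuous⟩
  have hc : IsCompact (closure (Set.range G)) := by
    refine BoundedContinuousFunction.arzela_ascoli (Metric.closedBall 0 ρ)
      (isCompact_closedBall _ _) _ ?_ ?_
    · rintro _ s ⟨n, rfl⟩
      rw [mem_closedBall_zero_iff]
      exact hb n s
    · refine (LipschitzWith.uniformEquicontinuous _ C ?_).equicontinuous
      rintro ⟨_, n, rfl⟩
      exact hlip n
  obtain ⟨g, -, u, hu, hg⟩ := hc.tendsto_subseq fun n => subset_closure (Set.mem_range_self n)
  obtain ⟨N, hN⟩ := Metric.cauchySeq_iff.1 hg.cauchySeq ε hε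
  refine ⟨u N, u (N + 1), (hu (Nat.lt_succ_self N)).ne, fun s => ?_⟩
  rw [← dist_eq_norm]
  exact (BoundedContinuousFunction.dist_coe_le_dist (f := G (u N)) (g := G (u (N + 1))) s).trans_lt
    (hN N le_rfl (N + 1) (Nat.le_succ N))

theorem finiteDimensional_of_selfAdjoint {A : Type*} [CStarAlgebra A]
    [FiniteDimensional ℝ (selfAdjoint A)] : FiniteDimensional ℂ A := by
  have : FiniteDimensional ℝ A := by
    refine Module.Finite.of_injective
      ((realPart : A →ₗ[ℝ] selfAdjoint A).prod (imaginaryPart : A →ₗ[ℝ] selfAdjoint A)) ?_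
    intro a b h
    have h1 : realPart a = realPart b := congrArg Prod.fst h
    have h2 : imaginaryPart a = imaginaryPart b := congrArg Prod.snd h
    rw [← realPart_add_I_smul_imaginaryPart a, ← realPart_add_I_smul_imaginaryPart b, h1, h2]
  exact Module.Finite.of_restrictScalars_finite ℝ ℂ A

/-- If the Monge-Kantorovich distance of `L` metrizes the weak* topology, and `L` is bounded with
respect to the norm on the image of an isometric real-linear map `ι : V → 𝔰𝔞(B)`, then `V` is
finite-dimensional. -/
theorem finiteDimensional_of_metrizes {B : Type*} [CStarAlgebra B] [Nontrivial B]
    {L : selfAdjoint B → ℝ≥0∞}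
    (hsmul : ∀ (t : ℝ) (a : selfAdjoint B), L (t • a) = ‖t‖ₑ * L a)
    (hmet : ∃ m : MetricSpace (stateSpace B),
      (∀ φ ψ : stateSpace B, mongeKantorovich L φ ψ = ENNReal.ofReal (m.dist φ ψ)) ∧
      m.toUniformSpace.toTopologicalSpace = weakStarTopology B)
    {V : Type*} [NormedAddCommGroup V] [NormedSpace ℝ V] (ι : V →ₗᵢ[ℝ] selfAdjoint B) {c : ℝ}
    (hc : 0 < c) (hL : ∀ v, L (ι v) ≤ ENNReal.ofReal (c * ‖v‖)) : FiniteDimensional ℝ V := by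
  obtain ⟨m, hm, htop⟩ := hmet
  by_contra hV
  -- Riesz's lemma: infinite dimension gives a 1-separated sequence in the ball of radius `R`.
  obtain ⟨R, f, hR, hf, hsep⟩ := exists_seq_norm_le_one_le_norm_sub hV
  have hcR : 0 < c * R := by positivity
  have hfin : ∀ φ ψ : stateSpace B, mongeKantorovich L φ ψ ≠ ∞ := fun φ ψ => by
    rw [hm]; exact ENNReal.ofReal_ne_top
  have hcomp : @CompactSpace (stateSpace B) m.toUniformSpace.toTopologicalSpace := by
    rw [htop]
    exact isCompact_iff_compactSpace.1 isCompact_stateSpace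
  -- As functions on states these are `c * R`-Lipschitz and bounded by `R`, so two of them are
  -- uniformly closer than 1.
  obtain ⟨i, j, hij, h⟩ := @exists_ne_forall_norm_sub_lt (stateSpace B) m hcomp
    (fun n φ => φ.1 (ι (f n) : B)) (Real.toNNReal (c * R)) R 1 one_pos
    (fun n => LipschitzWith.of_dist_le_mul fun φ ψ => by
      have h := norm_sub_le_mongeKantorovich hsmul (hfin φ ψ) hcR (a := ι (f n))
        ((hL _).trans (ENNReal.ofReal_le_ofReal (by gcongr; exact hf n)))
      rw [hm, ENNReal.toReal_ofReal dist_nonneg] at h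
      rw [dist_eq_norm, Real.coe_toNNReal _ hcR.le]
      exact h)
    (fun n φ => (stateSpace.norm_apply_sa_le φ (ι (f n)).2).trans ((ι.norm_map (f n)).trans_le (hf n)))
  -- A state attaining the norm of the difference contradicts 1-separation.
  obtain ⟨φ, hφ⟩ := exists_state_norm_apply_eq (ι (f i - f j)).2
  have h1 := h φ
  rw [← map_sub, ← AddSubgroup.coe_sub, ← map_sub, hφ] at h1
  exact absurd ((hsep hij).trans_eq (ι.norm_map _).symm) (not_le.2 h1)

end FiniteDimension

/-! ### Constant functions and the converse implication -/

section Constants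

variable {X : Type*} [MetricSpace X] [CompactSpace X] [Nonempty X] {A : Type*} [CStarAlgebra A]

variable (X A) in
/-- The embedding of the self-adjoint elements of `A` into `C(X, A)` as constant functions. -/
def constSelfAdjoint : selfAdjoint A →ₗᵢ[ℝ] selfAdjoint C(X, A) where
  toFun a := ⟨ContinuousMap.const X (a : A), by
    rw [selfAdjoint.mem_iff]
    ext x
    simp⟩
  map_add' a b := rfl
  map_smul' t a := rfl
  norm_map' a := by
    change ‖ContinuousMap.const X (a : A)‖ = ‖(a : A)‖
    rw [ContinuousMap.norm_eq_iSup_norm]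
    exact ciSup_const (ι := X) (a := ‖(a : A)‖)

theorem lipNorm_constSelfAdjoint_le {E : C(X, A) →ₗ[ℂ] scalarFunctions X A} {r : ℝ}
    (hE : IsConditionalExpectation E) (hr : 0 < r) (a : selfAdjoint A) :
    lipNorm E r (constSelfAdjoint X A a) ≤ ENNReal.ofReal (2 / r * ‖a‖) := by
  have h := norm_sub_apply_le hE (constSelfAdjoint X A a : C(X, A)) 0
  have hn : ‖(constSelfAdjoint X A a : C(X, A))‖ = ‖a‖ := (constSelfAdjoint X A).norm_map a
  rw [ZeroMemClass.coe_zero, sub_zero, hn] at h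
  have h0 : lipConst (constSelfAdjoint X A a : C(X, A)) = 0 := lipConst_const (a : A)
  rw [lipNorm, h0, zero_add, div_mul_eq_mul_div, ENNReal.ofReal_div_of_pos hr, ← ofReal_norm]
  gcongr

theorem finiteDimensional_of_isCompactQuantumMetricSpace
    {E : C(X, A) →ₗ[ℂ] scalarFunctions X A} {r : ℝ} (hE : IsConditionalExpectation E) (hr : 0 < r)
    (h : IsCompactQuantumMetricSpace (lipNorm E r)) : FiniteDimensional ℂ A := by
  -- The zero algebra has no states, so norm attainment fails there; it is finite-dimensional
  -- anyway.
  rcases subsingleton_or_nontrivial A with hA | hA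
  · infer_instance
  · have := finiteDimensional_of_metrizes h.smul_eq h.metrizes (constSelfAdjoint X A)
      (div_pos two_pos hr) (lipNorm_constSelfAdjoint_le hE hr)
    exact finiteDimensional_of_selfAdjoint

end Constants

end QuantumMetric
end

theorem theoremt {X : Type*} [MetricSpace X] [CompactSpace X] [Nonempty X]
    {A : Type*} [CStarAlgebra A]
    (E : C(X, A) →ₗ[ℂ] QuantumMetric.scalarFunctions X A)
    (hE : QuantumMetric.IsConditionalExpectation E)
    (r : ℝ) (hr : 0 < r) :
    QuantumMetric.IsQuasiLeibnizCQMS 2 (QuantumMetric.lipNorm E r) ↔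
      FiniteDimensional ℂ A :=
  ⟨fun h => QuantumMetric.finiteDimensional_of_isCompactQuantumMetricSpace hE hr h.1,
    fun _ => QuantumMetric.isQuasiLeibnizCQMS_lipNorm hE hr⟩
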